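/- Let $\Omega$ be a compact metric space, $T:\Omega\to\Omega$ a finite-to-one map, and $\mathcal X$ a Banach space of bounded Borel functions $\Omega\to\mathbb R$ that contains the constants, satisfies $fg\in\mathcal X$ and $\|fg\|\le\|f\|\,\|g\|$ for all $f,g\in\mathcal X$, satisfies $\|f\|\ge C\sup|f|$ for all $f\in\mathcal X$ and some constant $C>0$, and contains $\log f$ for every $f\in\mathcal X$ that is positive and bounded away from $0$. Assume: (i) $f\mapsto f\circ T$ and $f\mapsto\big(x\mapsto\sum_{T(y)=x}f(y)\big)$ are well-defined continuous operators on $\mathcal X$. (ii) For every $A\in\mathcal X$, the transfer operator $\mathcal L_A f(x)=\sum_{T(y)=x}e^{A(y)}f(y)$ has an eigenvalue $\lambda_A>0$ with an eigenfunction $h_A\in\mathcal X$ that is positive and bounded away from $0$. The dual operator $\mathcal L_A^*$ preserves the set of finite measures, and there is a Borel probability measure $\nu_A$ with $\int\mathcal L_Af\,d\nu_A=\lambda_A\int f\,d\nu_A$ for all $f\in\mathcal X$. There are constants $D,\delta>0$, depending on $A$, such that $\|\mathcal L_A^nf\|\le D\lambda_A^n(1-\delta)^n\|f\|$ for all $n\in\mathbb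 N$ and all $f\in\mathcal X$ with $\int f\,d\nu_A=0$. Normalize $h_A$ by $\int h_A\,d\nu_A=1$ and let $\mu_A=h_A\nu_A$ be the Gibbs measure of $A$. (iii) If $A,f\in\mathcal X$, $f\ge0$ and $\int f\,d\mu_A=0$, then $f=0$. (iv) Every continuous function $\Omega\to\mathbb R$ is a uniform limit of elements of $\mathcal X$. Let $\mathcal P_T$ be the set of $T$-invariant Borel probability measures on $\Omega$, and let $\mathcal C=\{c+g-g\circ T: c\in\mathbb R,\ g\in\mathcal X\}$. For $\mu\in\mathcal P_T$ and $B\in\mathcal X$ put $$h_{\mathcal X}(\mu)=\inf_{A\in\mathcal X}\Big(\log\lambda_A-\int A\,d\mu\Big),\qquad P_B(\mu)=h_{\mathcal X}(\mu)+\int B\,d\mu .$$ Let $\Phi=(\varphi_1,\dots,\varphi_K)\in\mathcal X^K$ be such that the classes $[\varphi_1],\dots,[\varphi_K]$ in $\mathcal X/\mathcal C$ are linearly independent and $0$ is an interior point of $$\mathrm{Rot}(\Phi)=\Big\{\Big(\int\varphi_1\,d\mu,\dots,\int\varphi_K\,d\mu\Big):\mu\in\mathcal P_T\Big\}\subset\mathbb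 R^K ,$$ and let $\mathcal P_T[\Phi]=\{\mu\in\mathcal P_T:\int\varphi_k\,d\mu=0\text{ for }k=1,\dots,K\}$. Then for every $B\in\mathcal X$ there is exactly one $(a_1,\dots,a_K)\in\mathbb R^K$ such that the Gibbs measure $\mu_{B_0}$ of $B_0=B+a_1\varphi_1+\dots+a_K\varphi_K$ lies in $\mathcal P_T[\Phi]$. Moreover, $P_B(\mu_{B_0})=\log\lambda_{B_0}$, and $P_B(\mu)<P_B(\mu_{B_0})$ for every $\mu\in\mathcal P_T[\Phi]$ with $\mu\neq\mu_{B_0}$. -/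

import Mathlib

open MeasureTheory
open scoped ENNReal

namespace Thermo

/-!
The space of potentials is a Banach algebra `X` together with an injective algebra homomorphism
`ι : X →ₐ[ℝ] (Ω → ℝ)`, that is, a space of functions on `Ω` that contains the constants and is
closed under products, with a complete submultiplicative norm (which need not be a sup norm).
For `f : X`, the function on `Ω` is `ι f`.
-/

section Functions

variable {Ω : Type*}

/-- The transfer operator `f ↦ (x ↦ ∑_{T y = x} e^{A y} f y)` of a potential `A`, acting on
functions. It is used only when all fibres of `T` are finite. -/
noncomputable def transfer (T : Ω → Ω) (A f : Ω → ℝ) : Ω → ℝ :=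
  fun x => ∑ᶠ y ∈ T ⁻¹' {x}, Real.exp (A y) * f y

/-- `f` is positive and bounded away from `0`. -/
def PosAwayFromZero (f : Ω → ℝ) : Prop := ∃ c : ℝ, 0 < c ∧ ∀ x, c ≤ f x

/-- The set of `T`-invariant Borel probability measures. -/
def invariantMeasures [MeasurableSpace Ω] (T : Ω → Ω) : Set (Measure Ω) :=
  {μ | IsProbabilityMeasure μ ∧ MeasurePreserving T μ μ}

end Functions

section Space

variable {Ω : Type*} [MeasurableSpace Ω]
variable {X : Type*} [NormedCommRing X] [NormedAlgebra ℝ X]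

/-- The functions `ι f` form a space of bounded Borel functions in which the norm dominates a
multiple of the sup norm, and which is stable under taking the logarithm of functions that are
positive and bounded away from `0`. Completeness of `X` is a separate instance. -/
structure IsPotentialSpace (ι : X →ₐ[ℝ] (Ω → ℝ)) : Prop where
  injective : Function.Injective ι
  measurable : ∀ f : X, Measurable (ι f)
  log_mem : ∀ f : X, PosAwayFromZero (ι f) → ∃ g : X, ∀ x, ι g x = Real.log (ι f x)
  sup_le_norm : ∃ C : ℝ, 0 < C ∧ ∀ (f : X) (x : Ω), C * |ι f x| ≤ ‖f‖

/-- `T` preserves the space of potentials forward and backward: `f ↦ f ∘ T` and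
`f ↦ (x ↦ ∑_{T y = x} f y)` are well-defined continuous linear operators on `X`. -/
structure PreservesPotentials (ι : X →ₐ[ℝ] (Ω → ℝ)) (T : Ω → Ω) : Prop where
  comp : ∃ U : X →L[ℝ] X, ∀ (f : X) (x : Ω), ι (U f) x = ι f (T x)
  fiberSum : ∃ S : X →L[ℝ] X, ∀ (f : X) (x : Ω), ι (S f) x = ∑ᶠ y ∈ T ⁻¹' {x}, ι f y

/-- `(lam, h, ν)` is the Ruelle-Perron-Frobenius data of the potential `A`: `lam > 0` is an
eigenvalue of the transfer operator with an eigenfunction `h ∈ X` that is positive and bounded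
away from `0`, `ν` is an eigenprobability of the dual operator for `lam`, `h` is normalized by
`∫ h dν = 1`, and the transfer operator has a spectral gap on the kernel of `ν`. -/
structure IsRPFData (ι : X →ₐ[ℝ] (Ω → ℝ)) (T : Ω → Ω) (A : X)
    (lam : ℝ) (h : X) (ν : Measure Ω) : Prop where
  lam_pos : 0 < lam
  h_pos : PosAwayFromZero (ι h)
  eigenfunction : ∀ x, transfer T (ι A) (ι h) x = lam * ι h x
  isProb : IsProbabilityMeasure ν
  eigenmeasure : ∀ f : X, ∫ x, transfer T (ι A) (ι f) x ∂ν = lam * ∫ x, ι f x ∂ν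
  normalized : ∫ x, ι h x ∂ν = 1
  /-- Here `g` is the element of `X` whose function is the `n`-th iterate of the transfer operator
  applied to `f`. -/
  gap : ∃ D δ : ℝ, 0 < D ∧ 0 < δ ∧ ∀ (n : ℕ) (f g : X), ∫ x, ι f x ∂ν = 0 →
    ι g = (transfer T (ι A))^[n] (ι f) → ‖g‖ ≤ D * lam ^ n * (1 - δ) ^ n * ‖f‖

/-- The basic setting: a finite-to-one map `T`, a space of potentials preserved by `T`, and a
Ruelle-Perron-Frobenius theorem for the transfer operators of all potentials. -/
structure IsRPFSystem (ι : X →ₐ[ℝ] (Ω → ℝ)) (T : Ω → Ω) : Prop where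
  finite_fibers : ∀ x, (T ⁻¹' {x}).Finite
  space : IsPotentialSpace ι
  preserves : PreservesPotentials ι T
  /-- The dual of every transfer operator preserves the set of finite measures. -/
  dual_measure : ∀ (A : X) (m : Measure Ω), IsFiniteMeasure m →
    ∃ m' : Measure Ω, IsFiniteMeasure m' ∧
      ∀ f : X, ∫ x, transfer T (ι A) (ι f) x ∂m = ∫ x, ι f x ∂m'
  rpf : ∀ A : X, ∃ (lam : ℝ) (h : X) (ν : Measure Ω), IsRPFData ι T A lam h ν

namespace IsRPFSystem

variable {ι : X →ₐ[ℝ] (Ω → ℝ)} {T : Ω → Ω}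

/-- The leading eigenvalue `λ_A`. -/
noncomputable def eigenvalue (H : IsRPFSystem ι T) (A : X) : ℝ := (H.rpf A).choose

/-- The leading eigenfunction `h_A`, normalized by `∫ h_A dν_A = 1`. -/
noncomputable def eigenfunction (H : IsRPFSystem ι T) (A : X) : X :=
  (H.rpf A).choose_spec.choose

/-- The eigenprobability `ν_A` of the dual of the transfer operator. -/
noncomputable def eigenmeasure (H : IsRPFSystem ι T) (A : X) : Measure Ω :=
  (H.rpf A).choose_spec.choose_spec.choose

theorem isRPFData (H : IsRPFSystem ι T) (A : X) :
    IsRPFData ι T A (H.eigenvalue A) (H.eigenfunction A) (H.eigenmeasure A) :=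
  (H.rpf A).choose_spec.choose_spec.choose_spec

/-- The Gibbs measure `μ_A = h_A ν_A`. -/
noncomputable def gibbs (H : IsRPFSystem ι T) (A : X) : Measure Ω :=
  (H.eigenmeasure A).withDensity fun x => ENNReal.ofReal (ι (H.eigenfunction A) x)

/-- The entropy `inf_A (log λ_A - ∫ A dμ)`, with values in the extended reals. -/
noncomputable def entropy (H : IsRPFSystem ι T) (μ : Measure Ω) : EReal :=
  ⨅ A : X, ((Real.log (H.eigenvalue A) - ∫ x, ι A x ∂μ : ℝ) : EReal)

/-- The functional `P_B(μ) = entropy(μ) + ∫ B dμ`. -/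
noncomputable def pressureFunctional (H : IsRPFSystem ι T) (B : X) (μ : Measure Ω) : EReal :=
  H.entropy μ + ((∫ x, ι B x ∂μ : ℝ) : EReal)

end IsRPFSystem

/-- The full setting: moreover, a non-negative potential whose integral against some Gibbs measure
vanishes is `0`, and potentials uniformly approximate all continuous functions. -/
structure IsThermoSystem [TopologicalSpace Ω] (ι : X →ₐ[ℝ] (Ω → ℝ)) (T : Ω → Ω) : Prop
    extends IsRPFSystem ι T where
  support : ∀ A f : X, (∀ x, 0 ≤ ι f x) →
    ∫ x, ι f x ∂(toIsRPFSystem.gibbs A) = 0 → f = 0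
  large : ∀ u : Ω → ℝ, Continuous u → ∀ ε : ℝ, 0 < ε → ∃ f : X, ∀ x, |u x - ι f x| < ε

/-- The rotation vector `(∫ φ_1 dμ, …, ∫ φ_K dμ)`. -/
noncomputable def rotationVector (ι : X →ₐ[ℝ] (Ω → ℝ)) {K : ℕ} (φ : Fin K → X)
    (μ : Measure Ω) : Fin K → ℝ :=
  fun k => ∫ x, ι (φ k) x ∂μ

/-- The set of rotation vectors of all invariant probability measures. -/
def rotationSet (ι : X →ₐ[ℝ] (Ω → ℝ)) (T : Ω → Ω) {K : ℕ} (φ : Fin K → X) :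
    Set (Fin K → ℝ) :=
  rotationVector ι φ '' invariantMeasures T

/-- The invariant probability measures `μ` with `∫ φ_k dμ = 0` for all `k`. -/
def constrainedMeasures (ι : X →ₐ[ℝ] (Ω → ℝ)) (T : Ω → Ω) {K : ℕ} (φ : Fin K → X) :
    Set (Measure Ω) :=
  {μ | μ ∈ invariantMeasures T ∧ ∀ k, ∫ x, ι (φ k) x ∂μ = 0}

end Space

section Coboundaries

variable {Ω : Type*} {X : Type*} [NormedCommRing X] [NormedAlgebra ℝ X]

/-- The subspace of potentials of the form `c + g - g ∘ T`, with `c` constant and `g ∈ X`. -/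
def coboundaries (ι : X →ₐ[ℝ] (Ω → ℝ)) (T : Ω → Ω) : Submodule ℝ X where
  carrier := {f | ∃ (c : ℝ) (g : X), ∀ x, ι f x = c + ι g x - ι g (T x)}
  zero_mem' := ⟨0, 0, fun x => by simp⟩
  add_mem' := by
    rintro f₁ f₂ ⟨c₁, g₁, h₁⟩ ⟨c₂, g₂, h₂⟩
    refine ⟨c₁ + c₂, g₁ + g₂, fun x => ?_⟩
    simp only [map_add, Pi.add_apply, h₁, h₂]
    ring
  smul_mem' := by
    rintro r f ⟨c, g, hf⟩
    refine ⟨r * c, r • g, fun x => ?_⟩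
    simp only [map_smul, Pi.smul_apply, smul_eq_mul, hf]
    ring

end Coboundaries

end Thermo

namespace Thermo

open Filter Topology

/-! ### Transfer operators on bounded functions -/

section Functions

variable {Ω : Type*} {T : Ω → Ω}

/-! Write p(A) = log λ_A for the pressure. Everything rests on the subgradients of p.

Normalize A to N_A = A + log h_A - (log h_A) ∘ T - p(A), so that L_{N_A} 1 = 1 and L_{N_A}^* fixes
μ_A. For a second potential A', put w = N_{A'} - N_A. Then ∫ e^w dμ_A = ∫ L_{N_{A'}} 1 dμ_A = 1,
hence ∫ (e^w - 1 - w) dμ_A = p(A') - p(A) - ∫ (A' - A) dμ_A. The integrand is non-negative, so μ_A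
is a subgradient of p at A (`log_eigenvalue_add_integral_le`). In the equality case the support
assumption gives w = 0, so A' - A lies in C (`sub_mem_coboundaries`). This yields uniqueness of a:
two solutions give opposite subgradient inequalities, hence equality, and the classes of the φ_k are
independent.

Existence comes from minimizing a ↦ p(B + ∑ a_k φ_k). Since p(A) ≥ ∫ A dμ for every invariant μ,
interiority of 0 in the rotation set makes this function coercive, and it is continuous. At a
minimizer, 0 is a slope of p below its graph in each direction φ_k. The directional subgradient is
unique and equals the Gibbs integral (`eq_integral_gibbs_of_forall_le_log_eigenvalue`), so ∫ φ_k dμ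
= 0.

The same uniqueness shows that an invariant measure whose functional P_B is at least p(B_0) under
the constraints is a subgradient at B_0, hence is μ_{B_0}. -/

theorem transfer_eq_sum (hT : ∀ x, (T ⁻¹' {x}).Finite) (A f : Ω → ℝ) (x : Ω) :
    transfer T A f x = ∑ y ∈ (hT x).toFinset, Real.exp (A y) * f y :=
  finsum_mem_eq_finite_toFinset_sum _ (hT x)

theorem transfer_congr {A A' f f' : Ω → ℝ} {x : Ω}
    (h : ∀ y, T y = x → Real.exp (A y) * f y = Real.exp (A' y) * f' y) :
    transfer T A f x = transfer T A' f' x :=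
  finsum_mem_congr rfl h

theorem mul_transfer (hT : ∀ x, (T ⁻¹' {x}).Finite) (A f : Ω → ℝ) (c : ℝ) (x : Ω) :
    c * transfer T A f x = transfer T A (fun y => c * f y) x := by
  rw [transfer_eq_sum hT, transfer_eq_sum hT, Finset.mul_sum]
  exact Finset.sum_congr rfl fun y _ => by ring

/-- First and second order estimates for the dependence of the transfer operator on the potential
in the direction of a bounded function `f`. -/
theorem abs_transfer_add_sub_le (hT : ∀ x, (T ⁻¹' {x}).Finite) {A f u : Ω → ℝ} {t F M : ℝ}
    (hf : ∀ x, |f x| ≤ F) (hu : ∀ x, |u x| ≤ M) (ht : 0 ≤ t) (htF : t * F ≤ 1) (x : Ω) :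
    |transfer T (fun y => A y + t * f y) u x - transfer T A u x|
      ≤ 2 * (t * F) * M * transfer T A 1 x ∧
    |transfer T (fun y => A y + t * f y) u x - transfer T A u x
        - t * transfer T A (fun y => f y * u y) x| ≤ (t * F) ^ 2 * M * transfer T A 1 x := by
  simp only [transfer_eq_sum hT, Finset.mul_sum, ← Finset.sum_sub_distrib]
  have htf : ∀ y, |t * f y| ≤ t * F := fun y => by
    rw [abs_mul, abs_of_nonneg ht]; exact mul_le_mul_of_nonneg_left (hf y) ht
  constructor
  · refine (Finset.abs_sum_le_sum_abs _ _).trans (Finset.sum_le_sum fun y _ => ?_)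
    have h1 := Real.abs_exp_sub_one_le ((htf y).trans htF)
    have : Real.exp (A y + t * f y) * u y - Real.exp (A y) * u y
        = Real.exp (A y) * ((Real.exp (t * f y) - 1) * u y) := by rw [Real.exp_add]; ring
    rw [this, abs_mul, abs_of_pos (Real.exp_pos _), abs_mul, mul_comm _ (Real.exp (A y) * _)]
    simp only [Pi.one_apply, mul_one]
    refine mul_le_mul_of_nonneg_left ?_ (Real.exp_pos _).le
    exact mul_le_mul (h1.trans (by linarith [htf y])) (hu y) (abs_nonneg _)
      (by linarith [htf y, abs_nonneg (t * f y)])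
  · refine (Finset.abs_sum_le_sum_abs _ _).trans (Finset.sum_le_sum fun y _ => ?_)
    have h1 := Real.abs_exp_sub_one_sub_id_le ((htf y).trans htF)
    have : Real.exp (A y + t * f y) * u y - Real.exp (A y) * u y
          - t * (Real.exp (A y) * (f y * u y))
        = Real.exp (A y) * ((Real.exp (t * f y) - 1 - t * f y) * u y) := by
      rw [Real.exp_add]; ring
    rw [this, abs_mul, abs_of_pos (Real.exp_pos _), abs_mul, mul_comm _ (Real.exp (A y) * _)]
    simp only [Pi.one_apply, mul_one]
    refine mul_le_mul_of_nonneg_left ?_ (Real.exp_pos _).le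
    refine mul_le_mul (h1.trans ?_) (hu y) (abs_nonneg _) (by positivity)
    rw [← sq_abs]
    exact pow_le_pow_left₀ (abs_nonneg _) (htf y) 2

end Functions

/-- The equation `G - P G = g` is solvable when the orbit of `g` under `P` decays exponentially. -/
theorem exists_sub_apply_eq_of_norm_pow_le {E : Type*} [NormedAddCommGroup E] [NormedSpace ℝ E]
    [CompleteSpace E] (P : E →L[ℝ] E) (g : E) {D r : ℝ} (hr0 : 0 ≤ r) (hr1 : r < 1)
    (h : ∀ n : ℕ, ‖(P ^ n) g‖ ≤ D * r ^ n) : ∃ G, G - P G = g := by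
  have hs : Summable fun n : ℕ => (P ^ n) g :=
    Summable.of_norm_bounded ((summable_geometric_of_lt_one hr0 hr1).mul_left D) h
  -- Neumann series: applying P shifts it, and only the term n = 0 survives in the difference.
  refine ⟨∑' n : ℕ, (P ^ n) g, ?_⟩
  rw [P.map_tsum hs, hs.tsum_eq_zero_add]
  simp [pow_succ']

section Space

variable {Ω : Type*} [MeasurableSpace Ω]
variable {X : Type*} [NormedCommRing X] [NormedAlgebra ℝ X] {ι : X →ₐ[ℝ] (Ω → ℝ)} {T : Ω → Ω}

/-! ### Pointwise bounds and exponentials of potentials -/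

namespace IsPotentialSpace

theorem exists_bound (S : IsPotentialSpace ι) (f : X) : ∃ M, 0 ≤ M ∧ ∀ x, |ι f x| ≤ M := by
  obtain ⟨C, hC, h⟩ := S.sup_le_norm
  refine ⟨‖f‖ / C, by positivity, fun x => ?_⟩
  rw [le_div_iff₀' hC]
  exact h f x

theorem integrable (S : IsPotentialSpace ι) (f : X) (μ : Measure Ω) [IsFiniteMeasure μ] :
    Integrable (ι f) μ := by
  obtain ⟨M, -, hM⟩ := S.exists_bound f
  exact Integrable.of_bound (S.measurable f).aestronglyMeasurable M
    (Eventually.of_forall fun x => by simpa using hM x)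

theorem continuous_apply (S : IsPotentialSpace ι) (x : Ω) : Continuous fun f : X => ι f x := by
  obtain ⟨C, hC, h⟩ := S.sup_le_norm
  let l : X →ₗ[ℝ] ℝ := (LinearMap.proj x).comp ι.toLinearMap
  exact (l.mkContinuous C⁻¹ fun f => by
    rw [inv_mul_eq_div, le_div_iff₀' hC]
    exact h f x).continuous

/-- Evaluation at a point is a continuous ring homomorphism, so it commutes with the exponential
series. Thus X is closed under pointwise exponentials. -/
theorem exp_apply [CompleteSpace X] (S : IsPotentialSpace ι) (f : X) (x : Ω) :
    ι (NormedSpace.exp f) x = Real.exp (ι f x) := by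
  have := NormedSpace.map_exp_of_mem_ball (𝕂 := ℝ)
    ((Pi.evalRingHom (fun _ : Ω => ℝ) x).comp (ι : X →+* (Ω → ℝ))) (S.continuous_apply x) f
    ((NormedSpace.expSeries_radius_eq_top ℝ X).symm ▸ edist_lt_top _ _)
  rw [← Real.exp_eq_exp_ℝ] at this
  exact this

theorem exp_sub_one_sub_nonneg [CompleteSpace X] (S : IsPotentialSpace ι) (w : X) (x : Ω) :
    0 ≤ ι (NormedSpace.exp w - 1 - w) x := by
  simp only [map_sub, map_one, Pi.sub_apply, Pi.one_apply, S.exp_apply]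
  linarith [Real.add_one_le_exp (ι w x)]

end IsPotentialSpace

/-! ### Transfer operators on X and Gibbs measures -/

namespace IsRPFSystem

/-- The operator is multiplication by e^A ∈ X followed by the fibre sum. -/
theorem exists_transferCLM [CompleteSpace X] (H : IsRPFSystem ι T) (A : X) :
    ∃ L : X →L[ℝ] X, ∀ f, ι (L f) = transfer T (ι A) (ι f) := by
  obtain ⟨S, hS⟩ := H.preserves.fiberSum
  refine ⟨S.comp (ContinuousLinearMap.mul ℝ X (NormedSpace.exp A)), fun f => ?_⟩
  ext x
  simp only [ContinuousLinearMap.comp_apply, ContinuousLinearMap.mul_apply', hS, map_mul,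
    Pi.mul_apply, H.space.exp_apply]
  rfl

theorem eigenvalue_pos (H : IsRPFSystem ι T) (A : X) : 0 < H.eigenvalue A :=
  (H.isRPFData A).lam_pos

instance isProbabilityMeasure_eigenmeasure (H : IsRPFSystem ι T) (A : X) :
    IsProbabilityMeasure (H.eigenmeasure A) :=
  (H.isRPFData A).isProb

theorem eigenfunction_pos (H : IsRPFSystem ι T) (A : X) (x : Ω) :
    0 < ι (H.eigenfunction A) x := by
  obtain ⟨c, hc, h⟩ := (H.isRPFData A).h_pos
  exact hc.trans_le (h x)

theorem integral_gibbs (H : IsRPFSystem ι T) (A : X) (u : Ω → ℝ) :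
    ∫ x, u x ∂(H.gibbs A) = ∫ x, ι (H.eigenfunction A) x * u x ∂(H.eigenmeasure A) := by
  rw [gibbs, integral_withDensity_eq_integral_toReal_smul
    (H.space.measurable _).ennreal_ofReal (by simp)]
  simp [ENNReal.toReal_ofReal (H.eigenfunction_pos A _).le]

instance isProbabilityMeasure_gibbs (H : IsRPFSystem ι T) (A : X) :
    IsProbabilityMeasure (H.gibbs A) := by
  refine ⟨?_⟩
  rw [gibbs, withDensity_apply _ MeasurableSet.univ, Measure.restrict_univ,
    ← ofReal_integral_eq_lintegral_ofReal (H.space.integrable _ _)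
      (Eventually.of_forall fun x => (H.eigenfunction_pos A x).le),
    (H.isRPFData A).normalized, ENNReal.ofReal_one]

/-! ### Spectral gap and differentiability of the pressure -/

/-- The spectral gap solves the Poisson equation of the transfer operator on the kernel of the
eigenmeasure. -/
theorem exists_sub_transfer_eq [CompleteSpace X] (H : IsRPFSystem ι T) (A g : X)
    (hg : ∫ x, ι g x ∂(H.eigenmeasure A) = 0) :
    ∃ G : X, ∀ x, ι G x - (H.eigenvalue A)⁻¹ * transfer T (ι A) (ι G) x = ι g x := by
  obtain ⟨L, hL⟩ := H.exists_transferCLM A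
  obtain ⟨D, δ, hD, hδ, hgap⟩ := (H.isRPFData A).gap
  have hlam := H.eigenvalue_pos A
  set lam := H.eigenvalue A
  have hpow : ∀ n : ℕ, ι ((L ^ n) g) = (transfer T (ι A))^[n] (ι g) := fun n => by
    induction n with
    | zero => simp
    | succ n ih => rw [Function.iterate_succ_apply', ← ih, ← hL, pow_succ',
        mul_apply_eq_comp]
  have hgap' : ∀ n : ℕ, ‖(L ^ n) g‖ ≤ D * lam ^ n * (1 - δ) ^ n * ‖g‖ :=
    fun n => hgap n g _ hg (hpow n)
  -- The gap constant δ may exceed 1. Then the bound at n = 1 has a negative factor and forces g =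
  -- 0.
  have key : ∃ r : ℝ, 0 ≤ r ∧ r < 1 ∧ ∀ n : ℕ, ‖(L ^ n) g‖ ≤ D * lam ^ n * r ^ n * ‖g‖ := by
    rcases le_or_gt δ 1 with h1 | h1
    · exact ⟨1 - δ, by linarith, by linarith, hgap'⟩
    · have h0 : ‖g‖ = 0 := by
        by_contra hne
        have hpos : 0 < ‖g‖ := lt_of_le_of_ne (norm_nonneg _) (Ne.symm hne)
        have h2 := (norm_nonneg _).trans (hgap' 1)
        have h3 : 0 < D * lam * (δ - 1) * ‖g‖ := by
          have := sub_pos.2 h1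
          positivity
        simp only [pow_one] at h2
        linarith
      refine ⟨0, le_rfl, one_pos, fun n => ?_⟩
      simp [norm_eq_zero.1 h0]
  obtain ⟨r, hr0, hr1, hr⟩ := key
  obtain ⟨G, hG⟩ := exists_sub_apply_eq_of_norm_pow_le (lam⁻¹ • L) g (D := D * ‖g‖) hr0 hr1
    fun n => by
      rw [smul_pow, smul_apply, norm_smul, Real.norm_eq_abs,
        abs_of_pos (by positivity), inv_pow, inv_mul_le_iff₀ (by positivity)]
      exact (hr n).trans_eq (by ring)
  refine ⟨G, fun x => ?_⟩
  rw [← hG, ← hL]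
  simp

/-- A lower bound for the slopes of the pressure in the direction of `f` is at most the integral of
`f` against the Gibbs measure. -/
theorem le_integral_gibbs_of_forall_le_log_eigenvalue [CompleteSpace X] (H : IsRPFSystem ι T)
    (A f : X) (c : ℝ)
    (hc : ∀ t : ℝ, Real.log (H.eigenvalue A) + t * c ≤ Real.log (H.eigenvalue (A + t • f))) :
    c ≤ ∫ x, ι f x ∂(H.gibbs A) := by
  obtain ⟨L, hL⟩ := H.exists_transferCLM A
  rw [integral_gibbs]
  have hlam := H.eigenvalue_pos A
  have hd := H.isRPFData A
  have hprob := H.isProbabilityMeasure_eigenmeasure A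
  set lam := H.eigenvalue A
  set h := H.eigenfunction A
  set ν := H.eigenmeasure A
  set m := ∫ x, ι h x * ι f x ∂ν with hm
  have hLh : ∀ x, ι (L h) x = lam * ι h x := fun x => by rw [hL]; exact hd.eigenfunction x
  have hg : ∫ x, ι (f * h - m • h) x ∂ν = 0 := by
    have h1 := H.space.integrable (f * h) ν
    have h2 := H.space.integrable (m • h) ν
    simp only [map_sub, Pi.sub_apply]
    rw [integral_sub h1 h2]
    simp only [map_mul, map_smul, Pi.mul_apply, Pi.smul_apply, smul_eq_mul]
    rw [integral_const_mul, hd.normalized, hm]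
    simp [mul_comm]
  obtain ⟨G₀, hG₀⟩ := H.exists_sub_transfer_eq A _ hg
  have hG₀' : G₀ - lam⁻¹ • L G₀ = f * h - m • h :=
    H.space.injective (funext fun x => by simp [hL, ← hG₀ x, lam])
  -- Applying L to the Poisson equation for f h - m h splits L(f h) into λ m h and the corrector G -
  -- λ⁻¹ L G.
  set G := L G₀ with hG
  have hLfh : ∀ x, ι (L (f * h)) x = lam * m * ι h x + (ι G x - lam⁻¹ * ι (L G) x) := fun x => by
    have : f * h = m • h + (G₀ - lam⁻¹ • L G₀) := by rw [hG₀']; abel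
    rw [this]
    simp only [map_add, map_smul, map_sub, Pi.add_apply, Pi.smul_apply, Pi.sub_apply, smul_eq_mul,
      hLh, ← hG]
    ring
  obtain ⟨F, hF0, hF⟩ := H.space.exists_bound f
  obtain ⟨M, hM0, hM⟩ := H.space.exists_bound h
  obtain ⟨N, hN0, hN⟩ := H.space.exists_bound G
  obtain ⟨Q, hQ0, hQ⟩ := H.space.exists_bound (L 1)
  obtain ⟨b, hb, hbh⟩ := hd.h_pos
  have hQ' : ∀ x, transfer T (ι A) 1 x ≤ Q := fun x => by
    have := (le_abs_self _).trans (hQ x)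
    rwa [hL, map_one] at this
  by_contra! hlt
  -- The three terms bound (λ' - λ) J, the first-order error on G, and λ times the second-order
  -- error on h.
  set K := 2 * F * M * Q / b * N + 2 * F * N * Q + lam * F ^ 2 * M * Q with hK
  -- Test the eigenmeasure ν' of A + t f on h and on G. On h, (λ' - λ) I = t ∫ L(f h) dν' + O(t²).
  -- On G, λ' J - J' = O(t), and λ' - λ = O(t), so the corrector contributes only O(t²) in total. No
  -- convergence of ν' to ν is needed.
  have hbound : ∀ t : ℝ, 0 < t → t * F ≤ 1 → lam * lam * (c - m) * b ≤ K * t := by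
    intro t ht htF
    have hd' := H.isRPFData (A + t • f)
    have hlam' := H.eigenvalue_pos (A + t • f)
    have hprob' := H.isProbabilityMeasure_eigenmeasure (A + t • f)
    have hct := hc t
    set lam' := H.eigenvalue (A + t • f)
    set ν' := H.eigenmeasure (A + t • f)
    obtain ⟨L', hL'⟩ := H.exists_transferCLM (A + t • f)
    have hιA : ι (A + t • f) = fun y => ι A y + t * ι f y := by
      ext y; simp
    have heig : ∀ u, ∫ x, ι (L' u) x ∂ν' = lam' * ∫ x, ι u x ∂ν' := fun u => by
      rw [hL']; exact hd'.eigenmeasure u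
    have int : ∀ u : X, Integrable (ι u) ν' := fun u => H.space.integrable u ν'
    have intle : ∀ (u : X) (C : ℝ), (∀ x, |ι u x| ≤ C) → |∫ x, ι u x ∂ν'| ≤ C := by
      intro u C hu
      have := norm_integral_le_of_norm_le_const (μ := ν') (f := ι u) (C := C)
        (Eventually.of_forall hu)
      simpa using this
    have est : ∀ (u : X) (C : ℝ), 0 ≤ C → (∀ x, |ι u x| ≤ C) →
        |lam' * ∫ x, ι u x ∂ν' - ∫ x, ι (L u) x ∂ν'| ≤ 2 * (t * F) * C * Q ∧
        |lam' * ∫ x, ι u x ∂ν' - ∫ x, ι (L u) x ∂ν' - t * ∫ x, ι (L (f * u)) x ∂ν'|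
          ≤ (t * F) ^ 2 * C * Q := by
      intro u C hC hu
      have e := abs_transfer_add_sub_le H.finite_fibers (A := ι A) hF hu ht.le htF
      have e1 : lam' * ∫ x, ι u x ∂ν' - ∫ x, ι (L u) x ∂ν' = ∫ x, ι (L' u - L u) x ∂ν' := by
        simp only [map_sub, Pi.sub_apply]
        rw [integral_sub (int _) (int _), heig]
      have e2 : lam' * ∫ x, ι u x ∂ν' - ∫ x, ι (L u) x ∂ν' - t * ∫ x, ι (L (f * u)) x ∂ν'
          = ∫ x, ι (L' u - L u - t • L (f * u)) x ∂ν' := by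
        rw [e1, map_sub ι (L' u - L u)]
        simp only [Pi.sub_apply]
        rw [integral_sub (int _) (int _)]
        simp [integral_const_mul]
      rw [e2, e1]
      constructor
      · refine intle _ _ fun x => ?_
        simp only [map_sub, Pi.sub_apply, hL, hL', hιA]
        exact (e x).1.trans (mul_le_mul_of_nonneg_left (hQ' x) (by positivity))
      · refine intle _ _ fun x => ?_
        simp only [map_sub, map_smul, Pi.sub_apply, Pi.smul_apply, smul_eq_mul, hL, hL', hιA,
          map_mul]
        exact (e x).2.trans (mul_le_mul_of_nonneg_left (hQ' x) (by positivity))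
    set I := ∫ x, ι h x ∂ν' with hI
    set J := ∫ x, ι G x ∂ν'
    set J' := ∫ x, ι (L G) x ∂ν'
    have hIb : b ≤ I := by
      have := integral_mono (integrable_const b) (int h) hbh
      simpa using this
    have hLhI : ∫ x, ι (L h) x ∂ν' = lam * I := by
      simp only [hLh, integral_const_mul, hI]
    have hLfhI : ∫ x, ι (L (f * h)) x ∂ν' = lam * m * I + (J - lam⁻¹ * J') := by
      have i1 : Integrable (fun x => ι G x - lam⁻¹ * ι (L G) x) ν' :=
        (int G).sub ((int (L G)).const_mul _)
      simp only [hLfh]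
      rw [integral_add ((int h).const_mul _) i1,
        integral_sub (int G) ((int (L G)).const_mul _), integral_const_mul, integral_const_mul]
    obtain ⟨h1, h2⟩ := est h M hM0 hM
    obtain ⟨h3, -⟩ := est G N hN0 hN
    rw [hLhI] at h1 h2
    rw [hLfhI] at h2
    have hdl : |lam' - lam| ≤ 2 * F * M * Q / b * t := by
      have : |lam' - lam| * b ≤ 2 * (t * F) * M * Q := by
        refine le_trans ?_ h1
        rw [← sub_mul, abs_mul]
        exact mul_le_mul_of_nonneg_left (hIb.trans (le_abs_self _)) (abs_nonneg _)
      rw [div_mul_eq_mul_div, le_div_iff₀ hb]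
      linarith
    have hJN : |J| ≤ N := intle G N hN
    have h4 : |(lam' - lam) * J| ≤ 2 * F * M * Q / b * t * N := by
      rw [abs_mul]
      exact mul_le_mul hdl hJN (abs_nonneg _) (by positivity)
    have hexp : lam * (1 + t * c) ≤ lam' := by
      have h5 := Real.exp_le_exp.2 hct
      rw [Real.exp_add, Real.exp_log hlam, Real.exp_log hlam'] at h5
      refine le_trans (mul_le_mul_of_nonneg_left ?_ hlam.le) h5
      linarith [Real.add_one_le_exp (t * c)]
    have h6 : lam * t * c * I ≤ (lam' - lam) * I :=
      mul_le_mul_of_nonneg_right (by linarith) (hb.le.trans hIb)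
    have h7 := (abs_le.1 h2).2
    have h8 := (abs_le.1 h3).2
    have h9 := (abs_le.1 h4).1
    have hJJ : lam * (J - lam⁻¹ * J') = lam * J - J' := by field_simp
    have h10 : t * (lam * (c - m) * I) ≤ t * ((J - lam⁻¹ * J') + t * F ^ 2 * M * Q) := by
      nlinarith
    have h11 := mul_le_mul_of_nonneg_left (le_of_mul_le_mul_left h10 ht) hlam.le
    have h12 : lam * J - J' ≤ 2 * F * M * Q / b * t * N + 2 * (t * F) * N * Q := by linarith
    have h13 : lam * lam * (c - m) * b ≤ lam * lam * (c - m) * I :=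
      mul_le_mul_of_nonneg_left hIb (by have := sub_pos.2 hlt; positivity)
    calc lam * lam * (c - m) * b ≤ lam * (lam * (c - m) * I) := by linarith
      _ ≤ (lam * J - J') + lam * (t * F ^ 2 * M * Q) := by rw [← hJJ]; linarith
      _ ≤ K * t := by rw [hK]; linarith
  have hlim : Tendsto (fun t : ℝ => K * t) (𝓝[>] 0) (𝓝 0) := by
    have : Tendsto (fun t : ℝ => K * t) (𝓝 0) (𝓝 (K * 0)) := tendsto_id.const_mul K
    rw [mul_zero] at this
    exact this.mono_left nhdsWithin_le_nhds
  have hsmall : ∀ᶠ t : ℝ in 𝓝[>] 0, t * F ≤ 1 := by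
    have : Tendsto (fun t : ℝ => t * F) (𝓝 0) (𝓝 (0 * F)) := tendsto_id.mul_const F
    rw [zero_mul] at this
    exact nhdsWithin_le_nhds ((this.eventually (gt_mem_nhds one_pos)).mono fun _ => le_of_lt)
  have hle : lam * lam * (c - m) * b ≤ 0 := by
    refine ge_of_tendsto hlim ?_
    filter_upwards [self_mem_nhdsWithin, hsmall] with t ht htF using hbound t ht htF
  have := sub_pos.2 hlt
  have : 0 < lam * lam * (c - m) * b := by positivity
  linarith

/-- The pressure is differentiable in the direction of `f`, with derivative the integral of `f`
against the Gibbs measure; stated as uniqueness of the subgradient. -/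
theorem eq_integral_gibbs_of_forall_le_log_eigenvalue [CompleteSpace X] (H : IsRPFSystem ι T)
    (A f : X) (c : ℝ)
    (hc : ∀ t : ℝ, Real.log (H.eigenvalue A) + t * c ≤ Real.log (H.eigenvalue (A + t • f))) :
    c = ∫ x, ι f x ∂(H.gibbs A) := by
  refine le_antisymm (H.le_integral_gibbs_of_forall_le_log_eigenvalue A f c hc) ?_
  have := H.le_integral_gibbs_of_forall_le_log_eigenvalue A (-f) (-c) fun t => by
    have := hc (-t)
    simpa using this
  simp only [map_neg, Pi.neg_apply, integral_neg] at this
  linarith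

/-! ### Normalization and convexity of the pressure -/

/-- Every potential is cohomologous, up to the constant `log λ_A`, to a normalized potential `N`,
whose dual transfer operator fixes the Gibbs measure of `A`. -/
theorem exists_normalized (H : IsRPFSystem ι T) (A : X) :
    ∃ N l : X, (∀ x, ι N x = ι A x + ι l x - ι l (T x) - Real.log (H.eigenvalue A)) ∧
      (∀ x, transfer T (ι N) 1 x = 1) ∧
      ∀ f : X, ∫ x, transfer T (ι N) (ι f) x ∂(H.gibbs A) = ∫ x, ι f x ∂(H.gibbs A) := by
  have hlam := H.eigenvalue_pos A
  have hpos := H.eigenfunction_pos A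
  have hd := H.isRPFData A
  obtain ⟨U, hU⟩ := H.preserves.comp
  obtain ⟨l, hl⟩ := H.space.log_mem _ hd.h_pos
  have hN : ∀ x, ι (A + l - U l - algebraMap ℝ X (Real.log (H.eigenvalue A))) x
      = ι A x + ι l x - ι l (T x) - Real.log (H.eigenvalue A) := fun x => by
    simp [hU]
  refine ⟨_, l, hN, ?_⟩
  set N := A + l - U l - algebraMap ℝ X (Real.log (H.eigenvalue A))
  -- On the fibre over x, h(T y) = h(x) leaves the sum, so L_N is L_A conjugated by h and divided by
  -- λ.
  have htr : ∀ (f : Ω → ℝ) (x : Ω), transfer T (ι N) f x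
      = (H.eigenvalue A * ι (H.eigenfunction A) x)⁻¹
        * transfer T (ι A) (fun y => ι (H.eigenfunction A) y * f y) x := fun f x => by
    rw [mul_transfer H.finite_fibers]
    refine transfer_congr fun y hy => ?_
    rw [hN, Real.exp_sub, Real.exp_sub, Real.exp_add, hl, hl, Real.exp_log hlam,
      Real.exp_log (hpos _), Real.exp_log (hpos _), hy]
    have := (hpos x).ne'
    field_simp
  constructor
  · intro x
    have h1 := hd.eigenfunction x
    have : (fun y => ι (H.eigenfunction A) y * (1 : Ω → ℝ) y) = ι (H.eigenfunction A) := by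
      ext; simp
    rw [htr, this, h1]
    exact inv_mul_cancel₀ (mul_pos hlam (hpos x)).ne'
  · intro f
    have h1 := hd.eigenmeasure (H.eigenfunction A * f)
    rw [integral_gibbs, integral_gibbs]
    have : ∀ x, ι (H.eigenfunction A) x * transfer T (ι N) (ι f) x
        = (H.eigenvalue A)⁻¹ * transfer T (ι A) (ι (H.eigenfunction A * f)) x := fun x => by
      rw [htr, map_mul]
      have := (hpos x).ne'
      simp only [Pi.mul_def]
      field_simp
    simp only [this]
    rw [integral_const_mul, h1, inv_mul_cancel_left₀ hlam.ne', map_mul]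
    rfl

/-- L_N(f ∘ T) = f · L_N 1 = f, and L_N^* fixes the Gibbs measure. -/
theorem integral_comp_gibbs [CompleteSpace X] (H : IsRPFSystem ι T) (A f : X) :
    ∫ x, ι f (T x) ∂(H.gibbs A) = ∫ x, ι f x ∂(H.gibbs A) := by
  obtain ⟨N, l, -, h1, h2⟩ := H.exists_normalized A
  obtain ⟨U, hU⟩ := H.preserves.comp
  simp only [← hU]
  rw [← h2]
  refine integral_congr_ae (Eventually.of_forall fun x => ?_)
  have h3 : transfer T (ι N) (ι (U f)) x = transfer T (ι N) (fun y => ι f x * 1) x :=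
    transfer_congr fun y hy => by rw [hU, hy, mul_one]
  have h4 := mul_transfer H.finite_fibers (ι N) 1 (ι f x) x
  simp only [Pi.one_apply, h1, mul_one] at h4
  simp only [mul_one] at h3
  rw [h3, ← h4]

theorem integral_comp_of_mem_invariantMeasures (H : IsRPFSystem ι T) {μ : Measure Ω}
    (hμ : μ ∈ invariantMeasures T) (f : X) : ∫ x, ι f (T x) ∂μ = ∫ x, ι f x ∂μ := by
  conv_rhs => rw [← hμ.2.map_eq]
  exact (integral_map hμ.2.measurable.aemeasurable
    (H.space.measurable f).aestronglyMeasurable).symm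

/-- Coboundaries integrate to 0. Invariance is asked only on potentials, so that this applies to
Gibbs measures before T is known to be measurable. -/
theorem integral_sub_comp (H : IsRPFSystem ι T) {μ : Measure Ω} [IsProbabilityMeasure μ]
    (hμ : ∀ f : X, ∫ x, ι f (T x) ∂μ = ∫ x, ι f x ∂μ) {A l N : X} {c : ℝ}
    (hN : ∀ x, ι N x = ι A x + ι l x - ι l (T x) - c) :
    ∫ x, ι N x ∂μ = ∫ x, ι A x ∂μ - c := by
  obtain ⟨U, hU⟩ := H.preserves.comp
  have int : ∀ u : X, Integrable (ι u) μ := fun u => H.space.integrable u μ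
  have : ∀ x, ι N x = ι (A + l - U l) x - c := fun x => by simp [hN, hU]
  simp only [this]
  rw [integral_sub (int _) (integrable_const c)]
  simp only [map_sub, Pi.sub_apply]
  rw [integral_sub (int _) (int _)]
  simp only [map_add, Pi.add_apply]
  rw [integral_add (int _) (int _)]
  simp [hU, hμ]

/-- The entropy of an invariant measure is non-negative. -/
theorem integral_le_log_eigenvalue (H : IsRPFSystem ι T) {μ : Measure Ω}
    (hμ : μ ∈ invariantMeasures T) (A : X) : ∫ x, ι A x ∂μ ≤ Real.log (H.eigenvalue A) := by
  have := hμ.1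
  obtain ⟨N, l, hN, h1, -⟩ := H.exists_normalized A
  have h2 := H.integral_sub_comp (H.integral_comp_of_mem_invariantMeasures hμ) hN
  -- e^{N(x)} is one of the positive terms of L_N 1 (T x) = 1.
  have h3 : ∀ x, ι N x ≤ 0 := fun x => by
    have h4 := h1 (T x)
    rw [transfer_eq_sum H.finite_fibers] at h4
    have h5 := Finset.single_le_sum (f := fun y => Real.exp (ι N y) * (1 : Ω → ℝ) y)
      (fun y _ => by simpa using (Real.exp_pos _).le)
      (show x ∈ (H.finite_fibers (T x)).toFinset by simp)
    rw [h4] at h5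
    simpa using h5
  have h6 := integral_nonpos (μ := μ) (f := ι N) h3
  linarith

/-- For two potentials, the difference `w` of their normalizations satisfies `∫ e^w dμ_A = 1`. -/
theorem exists_log_eigenvalue_sub [CompleteSpace X] (H : IsRPFSystem ι T) (A A' : X) :
    ∃ w l : X, (∀ x, ι w x = ι (A' - A) x + ι l x - ι l (T x)
        - (Real.log (H.eigenvalue A') - Real.log (H.eigenvalue A))) ∧
      ∫ x, ι (NormedSpace.exp w - 1 - w) x ∂(H.gibbs A)
        = Real.log (H.eigenvalue A') - Real.log (H.eigenvalue A)
          - ∫ x, ι (A' - A) x ∂(H.gibbs A) := by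
  obtain ⟨N, l, hN, -, h2⟩ := H.exists_normalized A
  obtain ⟨N', l', hN', h1', -⟩ := H.exists_normalized A'
  have hw : ∀ x, ι (N' - N) x = ι (A' - A) x + ι (l' - l) x - ι (l' - l) (T x)
        - (Real.log (H.eigenvalue A') - Real.log (H.eigenvalue A)) := fun x => by
    simp only [map_sub, Pi.sub_apply, hN, hN']
    ring
  refine ⟨N' - N, l' - l, hw, ?_⟩
  have int : ∀ u : X, Integrable (ι u) (H.gibbs A) := fun u => H.space.integrable u _
  have h3 := H.integral_sub_comp (H.integral_comp_gibbs A) hw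
  have h4 : ∫ x, ι (NormedSpace.exp (N' - N)) x ∂(H.gibbs A) = 1 := by
    rw [← h2]
    have : ∀ x, transfer T (ι N) (ι (NormedSpace.exp (N' - N))) x = 1 := fun x => by
      rw [← h1' x]
      refine transfer_congr fun y _ => ?_
      rw [H.space.exp_apply, ← Real.exp_add]
      simp
    simp [this]
  rw [map_sub]
  simp only [Pi.sub_apply]
  rw [integral_sub (int _) (int _), map_sub]
  simp only [Pi.sub_apply]
  rw [integral_sub (int _) (int 1), h4, h3]
  simp

/-- The Gibbs measure is a subgradient of the pressure. -/
theorem log_eigenvalue_add_integral_le [CompleteSpace X] (H : IsRPFSystem ι T) (A A' : X) :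
    Real.log (H.eigenvalue A) + ∫ x, ι (A' - A) x ∂(H.gibbs A)
      ≤ Real.log (H.eigenvalue A') := by
  obtain ⟨w, l, -, h⟩ := H.exists_log_eigenvalue_sub A A'
  have := integral_nonneg (μ := H.gibbs A) (f := ι (NormedSpace.exp w - 1 - w))
    (H.space.exp_sub_one_sub_nonneg w)
  linarith

/-- The subgradient inequalities at A and at A' enclose the difference between the integrals of A' -
A against the two Gibbs measures. -/
theorem abs_log_eigenvalue_sub_le [CompleteSpace X] (H : IsRPFSystem ι T) (A A' : X) (M : ℝ)
    (hM : ∀ x, |ι (A' - A) x| ≤ M) :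
    |Real.log (H.eigenvalue A') - Real.log (H.eigenvalue A)| ≤ M := by
  have bound : ∀ u : X, (∀ x, |ι u x| ≤ M) → ∀ C : X, |∫ x, ι u x ∂(H.gibbs C)| ≤ M := by
    intro u hu C
    have := norm_integral_le_of_norm_le_const (μ := H.gibbs C) (f := ι u) (C := M)
      (Eventually.of_forall hu)
    simpa using this
  have h1 := H.log_eigenvalue_add_integral_le A A'
  have h2 := H.log_eigenvalue_add_integral_le A' A
  have h3 := bound (A' - A) hM A
  have h4 := bound (A - A') (fun x => by
    have := hM x
    rwa [← neg_sub A A', map_neg, Pi.neg_apply, abs_neg] at this) A'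
  rw [abs_le] at h3 h4 ⊢
  constructor <;> linarith

/-- Up to a coboundary, two potentials differ by a constant if the subgradient inequality between
them is an equality. -/
theorem sub_mem_coboundaries [CompleteSpace X] (H : IsRPFSystem ι T) (A A' : X)
    (supp : ∀ f : X, (∀ x, 0 ≤ ι f x) → ∫ x, ι f x ∂(H.gibbs A) = 0 → f = 0)
    (heq : Real.log (H.eigenvalue A) + ∫ x, ι (A' - A) x ∂(H.gibbs A)
      = Real.log (H.eigenvalue A')) : A' - A ∈ coboundaries ι T := by
  obtain ⟨w, l, hw, h⟩ := H.exists_log_eigenvalue_sub A A'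
  have h0 := supp _ (H.space.exp_sub_one_sub_nonneg w) (by rw [h]; linarith)
  have hw0 : ∀ x, ι w x = 0 := fun x => by
    have h1 := congrArg (fun u => ι u x) h0
    simp only [map_sub, map_one, map_zero, Pi.sub_apply, Pi.one_apply, Pi.zero_apply,
      H.space.exp_apply] at h1
    -- The inequality 1 + s < e^s is strict for s ≠ 0.
    by_contra hne
    linarith [Real.add_one_lt_exp hne]
  refine ⟨Real.log (H.eigenvalue A') - Real.log (H.eigenvalue A), -l, fun x => ?_⟩
  have := hw x
  rw [hw0] at this
  simp only [map_neg, Pi.neg_apply]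
  linarith

theorem continuous_log_eigenvalue [CompleteSpace X] (H : IsRPFSystem ι T) :
    Continuous fun A => Real.log (H.eigenvalue A) := by
  obtain ⟨C, hC, h⟩ := H.space.sup_le_norm
  refine (LipschitzWith.of_dist_le_mul (K := C⁻¹.toNNReal) fun A' A => ?_).continuous
  rw [Real.dist_eq, dist_eq_norm, Real.coe_toNNReal _ (inv_pos.2 hC).le]
  refine H.abs_log_eigenvalue_sub_le A A' _ fun x => ?_
  rw [inv_mul_eq_div, le_div_iff₀' hC]
  exact h _ x

/-- By the subgradient inequality, the infimum is attained at A itself. -/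
theorem entropy_gibbs [CompleteSpace X] (H : IsRPFSystem ι T) (A : X) :
    H.entropy (H.gibbs A)
      = ((Real.log (H.eigenvalue A) - ∫ x, ι A x ∂(H.gibbs A) : ℝ) : EReal) := by
  refine le_antisymm (iInf_le _ A) (le_iInf fun A' => EReal.coe_le_coe_iff.2 ?_)
  have := H.log_eigenvalue_add_integral_le A A'
  simp only [map_sub, Pi.sub_apply] at this
  rw [integral_sub (H.space.integrable _ _) (H.space.integrable _ _)] at this
  linarith

theorem pressureFunctional_le (H : IsRPFSystem ι T) (A B : X) (μ : Measure Ω) :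
    H.pressureFunctional B μ
      ≤ ((Real.log (H.eigenvalue A) - ∫ x, ι A x ∂μ + ∫ x, ι B x ∂μ : ℝ) : EReal) := by
  rw [pressureFunctional, EReal.coe_add]
  exact add_le_add_left (iInf_le _ A) _

end IsRPFSystem

/-! ### From integrals of potentials to Borel measures -/

namespace IsThermoSystem

variable [MetricSpace Ω] [BorelSpace Ω]

/-- For continuous u, the function u ∘ T is a limit of functions f_n ∘ T with f_n ∈ X, which lie in
X and are Borel. Taking for u the distance to a closed set shows that its preimage is Borel. -/
theorem measurable_map (H : IsThermoSystem ι T) : Measurable T := by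
  obtain ⟨U, hU⟩ := H.preserves.comp
  have comp : ∀ u : Ω → ℝ, Continuous u → Measurable fun x => u (T x) := by
    intro u hu
    choose f hf using fun n : ℕ => H.large u hu (1 / ((n : ℝ) + 1)) (by positivity)
    refine measurable_of_tendsto_metrizable (fun n => H.space.measurable (U (f n))) ?_
    rw [tendsto_pi_nhds]
    intro x
    rw [tendsto_iff_dist_tendsto_zero]
    refine squeeze_zero (fun _ => dist_nonneg) (fun n => ?_)
      tendsto_one_div_add_atTop_nhds_zero_nat
    rw [hU, dist_comm]
    exact (hf n (T x)).le
  refine measurable_of_isClosed fun s hs => ?_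
  rcases s.eq_empty_or_nonempty with rfl | hne
  · simp
  · have : T ⁻¹' s = (fun x => Metric.infDist (T x) s) ⁻¹' {0} := by
      ext x
      simp [hs.mem_iff_infDist_zero hne]
    rw [this]
    exact comp _ (Metric.continuous_infDist_pt s) (measurableSet_singleton 0)

/-- The integrals of potentials determine a probability measure. -/
theorem measure_ext (H : IsThermoSystem ι T) {μ ν : Measure Ω} [IsProbabilityMeasure μ]
    [IsProbabilityMeasure ν] (h : ∀ f : X, ∫ x, ι f x ∂μ = ∫ x, ι f x ∂ν) : μ = ν := by
  refine ext_of_forall_integral_eq_of_IsFiniteMeasure fun u => ?_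
  have key : ∀ ε : ℝ, 0 < ε → |∫ x, u x ∂μ - ∫ x, u x ∂ν| ≤ 2 * ε := by
    intro ε hε
    obtain ⟨f, hf⟩ := H.large u u.continuous ε hε
    have est : ∀ (ρ : Measure Ω) [IsProbabilityMeasure ρ],
        |∫ x, u x ∂ρ - ∫ x, ι f x ∂ρ| ≤ ε := by
      intro ρ _
      rw [← integral_sub (u.integrable ρ) (H.space.integrable f ρ)]
      have := norm_integral_le_of_norm_le_const (μ := ρ) (f := fun x => u x - ι f x) (C := ε)
        (Eventually.of_forall fun x => (hf x).le)
      simpa using this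
    have h1 := est μ
    have h2 := est ν
    rw [h f] at h1
    rw [abs_le] at *
    constructor <;> linarith
  have : |∫ x, u x ∂μ - ∫ x, u x ∂ν| ≤ 0 :=
    le_of_forall_pos_le_add fun ε hε => by linarith [key (ε / 2) (by linarith)]
  exact sub_eq_zero.1 (abs_nonpos_iff.1 this)

theorem gibbs_mem_invariantMeasures [CompleteSpace X] (H : IsThermoSystem ι T) (A : X) :
    H.gibbs A ∈ invariantMeasures T := by
  have hT := H.measurable_map
  refine ⟨inferInstance, hT, ?_⟩
  have := Measure.isProbabilityMeasure_map (μ := H.gibbs A) hT.aemeasurable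
  refine H.measure_ext fun f => ?_
  rw [integral_map hT.aemeasurable (H.space.measurable f).aestronglyMeasurable]
  exact H.integral_comp_gibbs A f

/-- The Gibbs measure is the only equilibrium state. -/
theorem eq_gibbs [CompleteSpace X] (H : IsThermoSystem ι T) (A : X) (μ : Measure Ω)
    [IsProbabilityMeasure μ]
    (hμ : ∀ A' : X, Real.log (H.eigenvalue A) + ∫ x, ι (A' - A) x ∂μ
      ≤ Real.log (H.eigenvalue A')) : μ = H.gibbs A := by
  refine H.measure_ext fun f => ?_
  refine H.eq_integral_gibbs_of_forall_le_log_eigenvalue A f _ fun t => ?_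
  have := hμ (A + t • f)
  simpa [integral_const_mul] using this

end IsThermoSystem

/-! ### Minimizing the pressure over the span of the constraints -/

theorem integral_add_sum {μ : Measure Ω} (S : IsPotentialSpace ι) {K : ℕ} (φ : Fin K → X) (B : X)
    (a : Fin K → ℝ) [IsProbabilityMeasure μ] :
    ∫ x, ι (B + ∑ k, a k • φ k) x ∂μ = ∫ x, ι B x ∂μ + ∑ k, a k * ∫ x, ι (φ k) x ∂μ := by
  rw [map_add]
  simp only [Pi.add_apply]
  rw [integral_add (S.integrable _ _) (S.integrable _ _)]
  simp only [map_sum, map_smul, Finset.sum_apply, Pi.smul_apply, smul_eq_mul]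
  rw [integral_finsetSum _ fun k _ => (S.integrable (φ k) μ).const_mul (a k)]
  simp only [integral_const_mul]

/-- If `0` is interior to the rotation set, then the pressure is coercive along the span
of the constraints. -/
theorem IsRPFSystem.exists_norm_le_log_eigenvalue (H : IsRPFSystem ι T) {K : ℕ} (φ : Fin K → X)
    (h0 : (0 : Fin K → ℝ) ∈ interior (rotationSet ι T φ)) (B : X) :
    ∃ ε M : ℝ, 0 < ε ∧ ∀ a : Fin K → ℝ,
      ε * ‖a‖ - M ≤ Real.log (H.eigenvalue (B + ∑ k, a k • φ k)) := by
  obtain ⟨ε, hε, hball⟩ := Metric.isOpen_iff.1 isOpen_interior _ h0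
  obtain ⟨M, -, hM⟩ := H.space.exists_bound B
  refine ⟨ε / 2, M, by positivity, fun a => ?_⟩
  have hex : ∃ v : Fin K → ℝ, v ∈ rotationSet ι T φ ∧ ε / 2 * ‖a‖ ≤ ∑ k, a k * v k := by
    -- v has sup norm at most ε/2, so it is a rotation vector, and it pairs with a to ε/2 times the
    -- ℓ¹ norm of a, which dominates the sup norm.
    let v : Fin K → ℝ := fun k => ε / 2 * SignType.sign (a k)
    have hsign : ∀ r : ℝ, |(SignType.sign r : ℝ)| ≤ 1 := fun r => by
      rcases lt_trichotomy r 0 with h | h | h <;> simp [h]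
    refine ⟨v, interior_subset (hball ?_), ?_⟩
    · rw [mem_ball_zero_iff]
      refine lt_of_le_of_lt ((pi_norm_le_iff_of_nonneg (by positivity)).2 fun k => ?_)
        (half_lt_self hε)
      rw [Real.norm_eq_abs, abs_mul, abs_of_pos (half_pos hε)]
      exact mul_le_of_le_one_right (half_pos hε).le (hsign _)
    · have : ∑ k, a k * v k = ε / 2 * ∑ k, |a k| := by
        rw [Finset.mul_sum]
        exact Finset.sum_congr rfl fun k _ => by
          rw [mul_left_comm, self_mul_sign]
      rw [this]
      refine mul_le_mul_of_nonneg_left ?_ (half_pos hε).le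
      refine (pi_norm_le_iff_of_nonneg (Finset.sum_nonneg fun _ _ => abs_nonneg _)).2 fun k => ?_
      exact Finset.single_le_sum (f := fun k => |a k|) (fun _ _ => abs_nonneg _)
        (Finset.mem_univ k)
  obtain ⟨v, ⟨μ, hμ, rfl⟩, hv⟩ := hex
  have := hμ.1
  have h1 := H.integral_le_log_eigenvalue hμ (B + ∑ k, a k • φ k)
  rw [integral_add_sum H.space] at h1
  have h2 : |∫ x, ι B x ∂μ| ≤ M := by
    have := norm_integral_le_of_norm_le_const (μ := μ) (f := ι B) (C := M)
      (Eventually.of_forall hM)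
    simpa using this
  have h3 := (abs_le.1 h2).1
  simp only [rotationVector] at hv
  linarith

/-- The pressure attains its minimum on the span of the constraints, and the Gibbs measure of a
minimizer satisfies the constraints. -/
theorem IsThermoSystem.exists_gibbs_mem_constrainedMeasures [MetricSpace Ω] [BorelSpace Ω]
    [CompleteSpace X] (H : IsThermoSystem ι T) {K : ℕ} (φ : Fin K → X)
    (h0 : (0 : Fin K → ℝ) ∈ interior (rotationSet ι T φ)) (B : X) :
    ∃ a : Fin K → ℝ, H.gibbs (B + ∑ k, a k • φ k) ∈ constrainedMeasures ι T φ := by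
  obtain ⟨ε, M, hε, hcoer⟩ := H.exists_norm_le_log_eigenvalue φ h0 B
  have hcont : Continuous fun a : Fin K → ℝ =>
      Real.log (H.eigenvalue (B + ∑ k, a k • φ k)) :=
    H.continuous_log_eigenvalue.comp (by fun_prop)
  have hlim : Tendsto (fun a : Fin K → ℝ => Real.log (H.eigenvalue (B + ∑ k, a k • φ k)))
      (cocompact _) atTop :=
    tendsto_atTop_mono hcoer (tendsto_atTop_add_const_right _ _
      ((tendsto_norm_cocompact_atTop).const_mul_atTop hε))
  obtain ⟨a, ha⟩ := hcont.exists_forall_le hlim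
  refine ⟨a, H.gibbs_mem_invariantMeasures _, fun k => ?_⟩
  -- Minimality along the k-th coordinate line says that 0 is a subgradient in the direction φ_k.
  refine (H.eq_integral_gibbs_of_forall_le_log_eigenvalue _ (φ k) 0 fun t => ?_).symm
  have h1 := ha (a + Pi.single k t)
  have h2 : ∑ j, (a + Pi.single k t : Fin K → ℝ) j • φ j = ∑ j, a j • φ j + t • φ k := by
    simp only [Pi.add_apply, add_smul, Finset.sum_add_distrib]
    congr 1
    rw [Finset.sum_eq_single k (fun j _ hj => by simp [hj]) (by simp)]
    simp
  rw [h2, ← add_assoc] at h1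
  simpa using h1

end Space

end Thermo

theorem theoremF
    {Ω : Type*} [MetricSpace Ω] [CompactSpace Ω] [MeasurableSpace Ω] [BorelSpace Ω]
    {X : Type*} [NormedCommRing X] [NormedAlgebra ℝ X] [CompleteSpace X]
    (ι : X →ₐ[ℝ] (Ω → ℝ)) (T : Ω → Ω) (H : Thermo.IsThermoSystem ι T)
    {K : ℕ} (φ : Fin K → X)
    (hφ : LinearIndependent ℝ fun k => (Thermo.coboundaries ι T).mkQ (φ k))
    (h0 : (0 : Fin K → ℝ) ∈ interior (Thermo.rotationSet ι T φ))
    (B : X) :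
    (∃! a : Fin K → ℝ,
      H.gibbs (B + ∑ k, a k • φ k) ∈ Thermo.constrainedMeasures ι T φ) ∧
    ∀ (a : Fin K → ℝ) (B₀ : X), B₀ = B + ∑ k, a k • φ k →
      H.gibbs B₀ ∈ Thermo.constrainedMeasures ι T φ →
      H.pressureFunctional B (H.gibbs B₀) = ((Real.log (H.eigenvalue B₀) : ℝ) : EReal) ∧
      ∀ μ ∈ Thermo.constrainedMeasures ι T φ, μ ≠ H.gibbs B₀ →
        H.pressureFunctional B μ < H.pressureFunctional B (H.gibbs B₀) := by
  -- Constrained measures do not distinguish B from B_0, so P_B and P_{B_0} agree on them.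
  have hint : ∀ μ ∈ Thermo.constrainedMeasures ι T φ, ∀ a : Fin K → ℝ,
      ∫ x, ι (B + ∑ k, a k • φ k) x ∂μ = ∫ x, ι B x ∂μ := by
    intro μ hμ a
    have := hμ.1.1
    rw [Thermo.integral_add_sum H.space]
    simp [hμ.2]
  constructor
  · obtain ⟨a, ha⟩ := H.exists_gibbs_mem_constrainedMeasures φ h0 B
    refine ⟨a, ha, fun a' ha' => ?_⟩
    have hsub : ∀ μ ∈ Thermo.constrainedMeasures ι T φ, ∀ b b' : Fin K → ℝ,
        ∫ x, ι ((B + ∑ k, b' k • φ k) - (B + ∑ k, b k • φ k)) x ∂μ = 0 := by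
      intro μ hμ b b'
      have := hμ.1.1
      rw [map_sub]
      simp only [Pi.sub_apply]
      rw [integral_sub (H.space.integrable _ _) (H.space.integrable _ _), hint μ hμ, hint μ hμ,
        sub_self]
    have h1 := H.log_eigenvalue_add_integral_le (B + ∑ k, a k • φ k) (B + ∑ k, a' k • φ k)
    have h2 := H.log_eigenvalue_add_integral_le (B + ∑ k, a' k • φ k) (B + ∑ k, a k • φ k)
    rw [hsub _ ha] at h1
    rw [hsub _ ha'] at h2
    -- The inequalities `h1` and `h2` force equal pressures: the equality case of the subgradient
    -- inequality.
    have hmem := H.sub_mem_coboundaries (B + ∑ k, a k • φ k) (B + ∑ k, a' k • φ k)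
      (H.support _) (by rw [hsub _ ha]; linarith)
    rw [add_sub_add_left_eq_sub, ← Finset.sum_sub_distrib] at hmem
    have hzero : ∑ k, (a' k - a k) • (Thermo.coboundaries ι T).mkQ (φ k) = 0 := by
      simp only [← map_smul, ← map_sum]
      rw [Submodule.mkQ_apply, Submodule.Quotient.mk_eq_zero]
      simpa only [sub_smul] using hmem
    funext k
    exact sub_eq_zero.1 (Fintype.linearIndependent_iff.1 hφ (fun k => a' k - a k) hzero k)
  · rintro a B₀ rfl hG
    have hval : H.pressureFunctional B (H.gibbs (B + ∑ k, a k • φ k))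
        = ((Real.log (H.eigenvalue (B + ∑ k, a k • φ k)) : ℝ) : EReal) := by
      rw [Thermo.IsRPFSystem.pressureFunctional, H.entropy_gibbs, ← EReal.coe_add, hint _ hG]
      simp
    refine ⟨hval, fun μ hμ hne => ?_⟩
    rw [hval]
    by_contra! hle
    have := hμ.1.1
    -- If P_B(μ) ≥ log λ_{B_0}, then every term of the infimum defining the entropy is bounded below
    -- accordingly, which says that μ is a subgradient at B_0.
    refine hne (H.eq_gibbs _ μ fun A' => ?_)
    have h1 := EReal.coe_le_coe_iff.1 (hle.trans (H.pressureFunctional_le A' B μ))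
    rw [map_sub]
    simp only [Pi.sub_apply]
    rw [integral_sub (H.space.integrable _ _) (H.space.integrable _ _), hint μ hμ]
    linarith
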